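/- Let $V$ be a finite-dimensional complex vector space and let $\mathcal A$ be an essential central hyperplane arrangement in $V$, given by linear forms $l_1,\dots,l_n\in V^*$ with hyperplanes $H_i=\{x\in V: l_i(x)=0\}$ satisfying $H_1\cap\dots\cap H_n=\{0\}$. (Repeated hyperplanes are allowed and counted with multiplicity; a form $l_i=0$, with $H_i=V$, is also allowed.) Let $\mathbb C[V]$ denote the symmetric algebra of $V$, i.e. the polynomial ring whose linear forms are the vectors of $V$, and for $h\in V$ let $\rho_{\mathcal A}(h)$ be the number of indices $i$ with $h\notin H_i$. For $k\in\{0,-1,-2\}$ define the ideals of $\mathbb C[V]$ $$I_{\mathcal A,k}=\left\langle h^{\rho_{\mathcal A}(h)+k+1} : h\in V,\ h\neq 0\right\rangle,\qquad I'_{\mathcal A,k}=\left\langle h^{\rho_{\mathcal A}(h)+k+1} : h\neq 0 \text{ spans a line of } \mathcal A\right\rangle,$$ where a line of $\mathcal A$ is a one-dimensional subspace of $V$ that is an intersection of some of the hyperplanes $H_i$ (the empty intersection being $V$). Then $$I_{\mathcal A,k}=I'_{\mathcal A,k}\qquad\text{for each } k\in\{0,-1,-2\}.$$ -/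

import Mathlib

namespace PowerIdeal

variable {V : Type*} [AddCommGroup V] [Module ℂ V] {ι : Type*}

/-! A central arrangement in `V` is given by a family `l : ι → Module.Dual ℂ V` of linear forms,
with `ι` finite; its hyperplanes are the kernels `ker (l i)`. Hyperplanes may be repeated, and a
form may be zero (a loop of the arrangement, whose kernel is all of `V`).

The polynomial ring `ℂ[V]`, whose linear forms are the vectors of `V`, is `SymmetricAlgebra ℂ V`. -/

/-- The arrangement is essential: its hyperplanes meet only in the origin
(equivalently, the forms `l i` span the dual space). -/
def IsEssential (l : ι → Module.Dual ℂ V) : Prop :=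
  ⨅ i, LinearMap.ker (l i) = ⊥

/-- `rho l h` is the number of hyperplanes of the arrangement, counted with multiplicity,
that do not contain `h`. -/
noncomputable def rho (l : ι → Module.Dual ℂ V) (h : V) : ℕ :=
  {i : ι | h ∉ LinearMap.ker (l i)}.ncard

/-- `h` spans a line of the arrangement: a one-dimensional subspace which is the intersection of
some of the hyperplanes (the intersection of no hyperplanes being `V` itself). -/
def SpansLine (l : ι → Module.Dual ℂ V) (h : V) : Prop :=
  h ≠ 0 ∧ ∃ S : Set ι, Submodule.span ℂ {h} = ⨅ i ∈ S, LinearMap.ker (l i)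

/-- The ideal of `ℂ[V]` generated by the powers `h ^ (rho l h + k + 1)`, for the directions `h`
in `D`. The exponent is computed in `ℤ`: a direction with negative exponent gives no generator. -/
def directionIdeal (l : ι → Module.Dual ℂ V) (k : ℤ) (D : Set V) :
    Ideal (SymmetricAlgebra ℂ V) :=
  Ideal.span {g | ∃ h ∈ D, ∃ r : ℕ, (r : ℤ) = rho l h + k + 1 ∧
    g = SymmetricAlgebra.ι ℂ V h ^ r}

/-- The power ideal `I_{A,k}`, generated over all nonzero directions. -/
def powerIdeal (l : ι → Module.Dual ℂ V) (k : ℤ) : Ideal (SymmetricAlgebra ℂ V) :=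
  directionIdeal l k {h | h ≠ 0}

/-- The ideal `I'_{A,k}`, generated over the lines of the arrangement. -/
def lineIdeal (l : ι → Module.Dual ℂ V) (k : ℤ) : Ideal (SymmetricAlgebra ℂ V) :=
  directionIdeal l k {h | SpansLine l h}

/-- In an essential arrangement every nonzero vector is off some hyperplane, so that for `k ≥ -2`
all the exponents `rho l h + k + 1` are nonnegative and every direction contributes a generator. -/
theorem one_le_rho [Finite ι] {l : ι → Module.Dual ℂ V} (hl : IsEssential l) {h : V}
    (hh : h ≠ 0) : 1 ≤ rho l h := by
  rw [rho, Nat.one_le_iff_ne_zero, Ne, Set.ncard_eq_zero (Set.toFinite _)]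
  intro he
  apply hh
  have hm : h ∈ ⨅ i, LinearMap.ker (l i) := by
    rw [Submodule.mem_iInf]
    intro i
    by_contra hi
    have : i ∈ {i : ι | h ∉ LinearMap.ker (l i)} := hi
    rw [he] at this
    exact this
  rw [hl] at hm
  simpa using hm

end PowerIdeal

namespace PowerIdeal

/-! Strong induction on `rho l h`. If `h` spans no line, some `x` independent of `h` lies in every
hyperplane containing `h`. A vector `x - s • h` then lies in these and in the hyperplanes with `l i
x / l i h = s`, so its `rho` drops by their number. For each ratio that occurs, induction puts a
power of `x - s • h` in the ideal, and `pow_eq_zero_of_pencil` in the quotient ring combines these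
into the required power of `h`. -/

open Polynomial in
/-- Powers of the pencil `x - s • y` vanishing to high enough total order force `y ^ N = 0`:
a linear form applied to `(x + t • y) ^ N` is a polynomial in `t` of degree at most `N`
with more than `N` roots. -/
theorem pow_eq_zero_of_pencil {K A : Type*} [Field K] [Infinite K] [CommRing A] [Algebra K A]
    {x y : A} {N : ℕ} (S : Finset K) (c : K → ℕ) (hc : N < ∑ s ∈ S, c s)
    (h : ∀ s ∈ S, (x - s • y) ^ (N + 1 - c s) = 0) : y ^ N = 0 := by
  rw [← Module.forall_dual_apply_eq_zero_iff K]
  intro φ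
  let P : A → K[X] := fun z =>
    ∑ j ∈ Finset.range (N + 1), C (φ (y ^ j * z ^ (N - j) * (N.choose j : A))) * X ^ j
  have heval : ∀ z t, (P z).eval t = φ ((z + t • y) ^ N) := by
    intro z t
    rw [add_comm, add_pow, map_sum, eval_finsetSum]
    refine Finset.sum_congr rfl fun j _ => ?_
    rw [_root_.smul_pow, smul_mul_assoc, smul_mul_assoc, map_smul]
    rw [eval_mul, eval_C, eval_pow, eval_X, smul_eq_mul, mul_comm]
  have hcoeff : (P x).coeff N = φ (y ^ N) := by
    simp [P, coeff_C_mul, coeff_X_pow]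
  have hdeg : (P x).natDegree ≤ N :=
    natDegree_sum_le_of_forall_le _ _ fun j hj =>
      (natDegree_C_mul_X_pow_le _ _).trans (by simpa [Nat.lt_succ_iff] using hj)
  have hdvd : ∀ s ∈ S, (X + C s) ^ c s ∣ P x := by
    intro s hs
    -- Terms of degree `j < c s` contain `(x - s • y) ^ (N - j)`, which vanishes since `N - j ≥ N +
    -- 1 - c s`.
    have h1 : X ^ c s ∣ P (x - s • y) := by
      refine Finset.dvd_sum fun j _ => ?_
      rcases le_or_gt (c s) j with hj | hj
      · exact (pow_dvd_pow X hj).mul_left _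
      · have : (x - s • y) ^ (N - j) = 0 := pow_eq_zero_of_le (by omega) (h s hs)
        simp [this]
    have h2 : P x = (P (x - s • y)).comp (X + C s) := by
      refine Polynomial.funext fun t => ?_
      rw [eval_comp, heval, heval]
      congr 2
      simp only [eval_add, eval_X, eval_C, add_smul]
      abel
    obtain ⟨Q, hQ⟩ := h1
    rw [h2, hQ, mul_comp, pow_comp, X_comp]
    exact dvd_mul_right _ _
  have hprod : ∏ s ∈ S, (X + C s) ^ c s ∣ P x := by
    refine Finset.prod_dvd_of_coprime (fun s _ t _ hst => ?_) hdvd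
    refine IsCoprime.pow ?_
    have := isCoprime_X_sub_C_of_isUnit_sub (R := K) (a := -s) (b := -t)
      (sub_ne_zero.2 (by simpa using hst)).isUnit
    simpa using this
  have hzero : P x = 0 := by
    refine eq_zero_of_dvd_of_natDegree_lt hprod (hdeg.trans_lt ?_)
    rw [natDegree_prod_of_monic _ _ fun s _ => (monic_X_add_C s).pow _]
    simpa using hc
  rw [← hcoeff, hzero, coeff_zero]

variable {V : Type*} [AddCommGroup V] [Module ℂ V] {ι : Type*}

/-- A nonzero vector spanning no line of the arrangement has an independent companion lying in
all hyperplanes that contain it. -/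
theorem exists_notMem_span_of_not_spansLine {l : ι → Module.Dual ℂ V} {h : V} (hh : h ≠ 0)
    (hline : ¬ SpansLine l h) :
    ∃ x ∉ Submodule.span ℂ {h}, ∀ i, l i h = 0 → l i x = 0 := by
  by_contra! H
  refine hline ⟨hh, {i | l i h = 0}, le_antisymm ?_ fun x hx => ?_⟩
  · rw [Submodule.span_singleton_le_iff_mem]
    simp
  · by_contra hxs
    obtain ⟨i, hi, hxi⟩ := H x hxs
    simp only [Submodule.mem_iInf] at hx
    exact hxi (hx i hi)

theorem rho_eq_card [Fintype ι] [DecidableEq ℂ] (l : ι → Module.Dual ℂ V) (h : V) :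
    rho l h = (Finset.univ.filter fun i => l i h ≠ 0).card := by
  rw [rho, ← Set.ncard_coe_finset]
  simp

theorem pow_mem_lineIdeal [Finite ι] {l : ι → Module.Dual ℂ V} (hl : IsEssential l) {k : ℤ}
    (hk : k ≤ 0) (hk' : -2 ≤ k) (n : ℕ) : ∀ h : V, h ≠ 0 → rho l h = n →
    ∀ r : ℕ, (r : ℤ) = rho l h + k + 1 → SymmetricAlgebra.ι ℂ V h ^ r ∈ lineIdeal l k := by
  classical
  have := Fintype.ofFinite ι
  induction n using Nat.strong_induction_on with
  | _ n ih =>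
    intro h hh hn r hr
    by_cases hline : SpansLine l h
    · exact Ideal.subset_span ⟨h, hline, r, hr, rfl⟩
    obtain ⟨x, hx, hxl⟩ := exists_notMem_span_of_not_spansLine hh hline
    set T : Finset ι := Finset.univ.filter fun i => l i h ≠ 0 with hT
    have hTn : T.card = n := by rw [← hn, rho_eq_card]
    let q : ι → ℂ := fun i => l i x / l i h
    let m : ℂ → ℕ := fun s => (T.filter fun i => q i = s).card
    have hw : ∀ s, x - s • h ≠ 0 := fun s hs =>
      hx (Submodule.mem_span_singleton.2 ⟨s, (sub_eq_zero.1 hs).symm⟩)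
    have hrho : ∀ s, rho l (x - s • h) + m s = n := by
      intro s
      rw [← hTn, rho_eq_card, ← Finset.card_filter_add_card_filter_not (s := T) (fun i => q i = s),
        add_comm]
      congr 2
      ext i
      by_cases hi : l i h = 0
      · simp [hT, hi, hxl i hi]
      · simp [hT, hi, q, div_eq_iff hi, sub_eq_zero]
    -- With a single ratio `s`, the nonzero vector `x - s • h` would lie in every hyperplane,
    -- contradicting essentiality.
    have hS : 2 ≤ (T.image q).card := by
      by_contra! hlt
      have hpos : 0 < T.card := by
        rw [hTn, ← hn]
        exact one_le_rho hl hh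
      obtain ⟨i, hi⟩ := Finset.card_pos.1 hpos
      have hcard := Finset.card_le_one.1 (Nat.lt_succ_iff.1 hlt)
      have hm : m (q i) = n := by
        rw [← hTn]
        refine congrArg Finset.card ?_
        exact Finset.filter_true_of_mem fun j hj =>
          hcard _ (Finset.mem_image_of_mem q hj) _ (Finset.mem_image_of_mem q hi)
      have h1 := one_le_rho hl (hw (q i))
      have h2 := hrho (q i)
      omega
    rw [← Ideal.Quotient.eq_zero_iff_mem, map_pow]
    -- The orders `m s + 1` sum to `n` plus the number of ratios, at least `n + 2`; this exceeds `r
    -- = n + k + 1` because `k ≤ 0`.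
    refine pow_eq_zero_of_pencil (K := ℂ)
      (x := Ideal.Quotient.mk (lineIdeal l k) (SymmetricAlgebra.ι ℂ V x))
      (T.image q) (fun s => m s + 1) ?_ fun s hs => ?_
    · have hsum : T.card = ∑ s ∈ T.image q, m s := Finset.card_eq_sum_card_image q T
      rw [Finset.sum_add_distrib, ← hsum, hTn]
      simp only [Finset.sum_const, smul_eq_mul, mul_one]
      omega
    · obtain ⟨i, hi, his⟩ := Finset.mem_image.1 hs
      have hm : 0 < m s := Finset.card_pos.2 ⟨i, Finset.mem_filter.2 ⟨hi, his⟩⟩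
      have h1 := one_le_rho hl (hw s)
      have h2 := hrho s
      -- The natural subtraction does not truncate: `rho l (x - s • h) ≥ 1` and `k ≥ -2`.
      have := ih (rho l (x - s • h)) (by omega) _ (hw s) rfl (r + 1 - (m s + 1)) (by omega)
      rw [← Ideal.Quotient.eq_zero_iff_mem, map_pow, map_sub, map_sub, map_smul] at this
      exact this

end PowerIdeal

theorem theorem4p17 {V : Type*} [AddCommGroup V] [Module ℂ V] [FiniteDimensional ℂ V]
    {ι : Type*} [Finite ι] (l : ι → Module.Dual ℂ V) (hl : PowerIdeal.IsEssential l)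
    (k : ℤ) (hk : k ∈ ({0, -1, -2} : Set ℤ)) :
    PowerIdeal.powerIdeal l k = PowerIdeal.lineIdeal l k := by
  have hk : k ≤ 0 ∧ -2 ≤ k := by
    rcases hk with rfl | rfl | rfl <;> norm_num
  refine le_antisymm (Ideal.span_le.2 ?_) (Ideal.span_mono ?_)
  · rintro _ ⟨h, hh, r, hr, rfl⟩
    exact PowerIdeal.pow_mem_lineIdeal hl hk.1 hk.2 _ h hh rfl r hr
  · rintro _ ⟨h, hh, hr⟩
    exact ⟨h, hh.1, hr⟩
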